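/- \textbf{Theorem (Strong normalization).} Every $c$-term of the combinatory calculus CCL is strongly normalizing, i.e. there is no infinite reduction sequence $T = T_0 \triangleright T_1 \triangleright T_2 \triangleright \cdots$ starting from a $c$-term $T$. Here CCL is defined as follows. Given a set $\mathcal{A}$ of base types, the $m$-types are $A ::= a \mid a^{\perp} \mid A\wedge A \mid A\vee A$ with $a\in\mathcal{A}$, and the types are the $m$-types and $\perp$. The negation of an $m$-type is given by $(a)^{\perp}=a^{\perp}$, $(a^{\perp})^{\perp}=a$, $(A\wedge B)^{\perp}=A^{\perp}\vee B^{\perp}$, $(A\vee B)^{\perp}=A^{\perp}\wedge B^{\perp}$. Terms are built from countably many variables and the constants $\mathbf{K},\mathbf{S},\mathbf{C},\mathbf{P},\mathbf{Q_1},\mathbf{Q_2}$ by the two binary constructions $(U\;V)$ and $U\star V$; application associates to the left, and $\mathbf{I}=(\mathbf{S}\;\mathbf{K}\;\mathbf{K})$. Let $\Gamma$ range over finite sets of declarations $x:A$ with $A$ an $m$-type and at most one declaration per variable. The typing judgment $\Gamma\vdash T:D$ ($D$ a type) is generated by the following rules, for all $m$-types $A,B,C$: \begin{itemize} \item $\Gamma\vdash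 x:A$ if $(x:A)\in\Gamma$; \item $\Gamma\vdash\mathbf{K}:A^{\perp}\vee(B\vee A)$; \item $\Gamma\vdash\mathbf{S}:(A\wedge(B\wedge C^{\perp}))\vee((A\wedge B^{\perp})\vee(A^{\perp}\vee C))$; \item $\Gamma\vdash\mathbf{C}:(A\wedge B)\vee((A\wedge B^{\perp})\vee A^{\perp})$; \item $\Gamma\vdash\mathbf{P}:A^{\perp}\vee(B^{\perp}\vee(A\wedge B))$; \item $\Gamma\vdash\mathbf{Q_1}:A^{\perp}\vee(A\vee B)$ and $\Gamma\vdash\mathbf{Q_2}:B^{\perp}\vee(A\vee B)$; \item if $\Gamma\vdash U:A^{\perp}\vee B$ and $\Gamma\vdash V:A$, then $\Gamma\vdash(U\;V):B$; \item if $\Gamma\vdash U:A^{\perp}$ and $\Gamma\vdash V:A$, then $\Gamma\vdash U\star V:\perp$. \end{itemize} A $c$-term is a term $T$ such that $\Gamma\vdash T:D$ for some $\Gamma$ and some type $D$. The one-step reduction $\triangleright$ is the closure under term contexts of the rules \begin{align*} (\mathbf{K}\;U\;V)&\triangleright U, & (\mathbf{S}\;U\;V\;W)&\triangleright((U\;W)\;(V\;W)),\\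 (\mathbf{C}\;U\;V)\star W&\triangleright(U\;W)\star(V\;W), & W\star(\mathbf{C}\;U\;V)&\triangleright(U\;W)\star(V\;W),\\ (\mathbf{C}\;(\mathbf{K}\;U)\;\mathbf{I})&\triangleright U, & (\mathbf{C}\;\mathbf{I}\;(\mathbf{K}\;U))&\triangleright U,\\ (\mathbf{P}\;U\;V)\star(\mathbf{Q_1}\;W)&\triangleright U\star W, & (\mathbf{P}\;U\;V)\star(\mathbf{Q_2}\;W)&\triangleright V\star W,\\ (\mathbf{Q_1}\;W)\star(\mathbf{P}\;U\;V)&\triangleright W\star U, & (\mathbf{Q_2}\;W)\star(\mathbf{P}\;U\;V)&\triangleright W\star V, \end{align*} and $$W[x:=(\mathbf{C}\;(\mathbf{K}\;U)\;(\mathbf{K}\;V))]\triangleright U\star V\quad\text{if } W \text{ is a } c\text{-term of type } \perp \text{ and } x \text{ occurs in } W.$$ -/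

import Mathlib

universe u

namespace CCL

/-- The `m`-types over a set `Atom` of base types: base types `a`, dual base types `a^⊥`,
conjunctions and disjunctions. -/
inductive MType (Atom : Type u) : Type u
  | pos (a : Atom) : MType Atom
  | neg (a : Atom) : MType Atom
  | and (A B : MType Atom) : MType Atom
  | or (A B : MType Atom) : MType Atom

/-- The negation `A^⊥` of an `m`-type (an operation on `m`-types, not a connective). -/
def MType.perp {Atom : Type u} : MType Atom → MType Atom
  | .pos a => .neg a
  | .neg a => .pos a
  | .and A B => .or A.perp B.perp
  | .or A B => .and A.perp B.perp

/-- The types: the `m`-types together with `⊥`. -/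
inductive Ty (Atom : Type u) : Type u
  | m (A : MType Atom) : Ty Atom
  | bot : Ty Atom

/-- Raw terms: variables, the combinators `K, S, C, P, Q₁, Q₂`, application `(U V)`
and `U ⋆ V`. The `c`-terms are the raw terms that can be typed by `HasType` below. -/
inductive Term : Type
  | var (x : ℕ) : Term
  | K : Term
  | S : Term
  | C : Term
  | P : Term
  | Q₁ : Term
  | Q₂ : Term
  | app (U V : Term) : Term
  | star (U V : Term) : Term

namespace Term

/-- The combinator `I = (S K K)`. -/
def I : Term := app (app S K) K

/-- `x ∈ Var(T)`. -/
def Occurs (x : ℕ) : Term → Prop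
  | var y => x = y
  | app U V => Occurs x U ∨ Occurs x V
  | star U V => Occurs x U ∨ Occurs x V
  | _ => False

/-- The substitution `T[x := N]` (terms have no binders). -/
def subst (x : ℕ) (N : Term) : Term → Term
  | var y => if y = x then N else var y
  | app U V => app (subst x N U) (subst x N V)
  | star U V => star (subst x N U) (subst x N V)
  | K => K
  | S => S
  | C => C
  | P => P
  | Q₁ => Q₁
  | Q₂ => Q₂

end Term

/-- A set of declarations of variables: a finite set of declarations `x : A`, with `A` an
`m`-type and at most one declaration for each variable. -/
abbrev Ctx (Atom : Type u) : Type u := Finmap (fun _ : ℕ => MType Atom)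

open Term MType in
/-- The typing judgment `Γ ⊢ T : A` (in the Hilbert style). -/
inductive HasType {Atom : Type u} (Γ : Ctx Atom) : Term → Ty Atom → Prop
  | var (x : ℕ) (A : MType Atom) (h : Γ.lookup x = some A) : HasType Γ (var x) (.m A)
  | K (A B : MType Atom) : HasType Γ K (.m (or A.perp (or B A)))
  | S (A B C : MType Atom) :
      HasType Γ S (.m (or (and A (and B C.perp)) (or (and A B.perp) (or A.perp C))))
  | C (A B : MType Atom) : HasType Γ C (.m (or (and A B) (or (and A B.perp) A.perp)))
  | P (A B : MType Atom) : HasType Γ P (.m (or A.perp (or B.perp (and A B))))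
  | Q₁ (A B : MType Atom) : HasType Γ Q₁ (.m (or A.perp (or A B)))
  | Q₂ (A B : MType Atom) : HasType Γ Q₂ (.m (or B.perp (or A B)))
  | app (A B : MType Atom) (U V : Term) (hU : HasType Γ U (.m (or A.perp B)))
      (hV : HasType Γ V (.m A)) : HasType Γ (app U V) (.m B)
  | star (A : MType Atom) (U V : Term) (hU : HasType Γ U (.m A.perp))
      (hV : HasType Γ V (.m A)) : HasType Γ (star U V) .bot

open Term in
/-- One-step reduction `T ▷ T'`: the closure under term contexts of the reduction rules.
The set of base types matters only for the side condition of the rule `simp`, which asks that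
`W` has type `⊥` under some declarations and that `x` does occur in `W`. -/
inductive Red (Atom : Type u) : Term → Term → Prop
  | k (U V : Term) : Red Atom (app (app K U) V) U
  | s (U V W : Term) :
      Red Atom (app (app (app S U) V) W) (app (app U W) (app V W))
  | c_r (U V W : Term) :
      Red Atom (star (app (app C U) V) W) (star (app U W) (app V W))
  | c_l (U V W : Term) :
      Red Atom (star W (app (app C U) V)) (star (app U W) (app V W))
  | e_r (U : Term) : Red Atom (app (app C (app K U)) I) U
  | e_l (U : Term) : Red Atom (app (app C I) (app K U)) U
  | pq₁ (U V W : Term) :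
      Red Atom (star (app (app P U) V) (app Q₁ W)) (star U W)
  | pq₂ (U V W : Term) :
      Red Atom (star (app (app P U) V) (app Q₂ W)) (star V W)
  | qp₁ (U V W : Term) :
      Red Atom (star (app Q₁ W) (app (app P U) V)) (star W U)
  | qp₂ (U V W : Term) :
      Red Atom (star (app Q₂ W) (app (app P U) V)) (star W V)
  | simp (W U V : Term) (x : ℕ) (hW : ∃ Γ : Ctx Atom, HasType Γ W .bot) (hx : Occurs x W) :
      Red Atom (subst x (app (app C (app K U)) (app K V)) W) (star U V)
  | app_left {U U' : Term} (V : Term) (h : Red Atom U U') : Red Atom (app U V) (app U' V)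
  | app_right (U : Term) {V V' : Term} (h : Red Atom V V') : Red Atom (app U V) (app U V')
  | star_left {U U' : Term} (V : Term) (h : Red Atom U U') : Red Atom (star U V) (star U' V)
  | star_right (U : Term) {V V' : Term} (h : Red Atom V V') : Red Atom (star U V) (star U V')

/-- `T` is strongly normalizing: every reduction sequence from `T` is finite, expressed as
accessibility (well-foundedness of reduction below `T`). -/
def StronglyNormalizing (Atom : Type u) (T : Term) : Prop :=
  Acc (fun T₂ T₁ : Term => Red Atom T₁ T₂) T

end CCL

/-!
Strong normalization is proved by reducibility, with candidates in the symmetric style of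
Barbanera and Berardi.

In a typed term `⋆` occurs at the root only, so the rules for `⋆` and the erasing rule `simp` act at
the root, and below it only the rules for `K`, `S` and the two `η`-like rules for `C` act (`MRed`).
The difficulty is `simp`, which replaces a whole term `W[x := C (K U) (K V)]` by `U ⋆ V`. It is
absorbed by enlarging reduction (`Step`): *any* term having `C (K U) (K V)` as a subterm, whatever
its type, may escape to `U ⋆ V`. Then an escape of `U ⋆ V` or of `U V` is an escape of one of the two
components, unless the term is itself `C (K U') (K V')`, and this single case is settled when
`C a b` is shown reducible.

The interpretations `⟪A⟫` and `⟪A^⊥⟫` are defined together. The condition on a term `C a b` in `⟪A⟫`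
is that `a u ⋆ b u` is strongly normalizing for every `u` in `⟪A^⊥⟫`, and conversely; as each set
depends antitonically on the other one, a least fixed point of the composition exists (`pair`).
A disjunction `A ∨ B` is at the same time the function type `A^⊥ → B`, so membership in `⟪A ∨ B⟫`
constrains both the injections to which a term reduces and its values on `⟪A^⊥⟫` (`mem_interp`).

The candidates consist of terms typed in a system where every variable has every type
(`HasTy`). Types are needed for the rules `C (K U) I ▷ U` and `C I (K U) ▷ U`: typing forces the type
of `U` to be that of the redex. Since a variable has every type, every candidate is inhabited.
The proof is carried by `mem_interp_of_reducts` (a term which is not a partially applied combinator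
belongs to `⟪A⟫` as soon as its reducts do), `sn_star_of_mem` (orthogonality of `⟪A⟫` and `⟪A^⊥⟫`),
`C_app_app_mem` and `HasTy.mem_interp` (adequacy).
-/

namespace CCL

open Term

variable {Atom : Type u}

/-! ### Negation and typing with unconstrained variables -/

@[simp] theorem MType.perp_perp (A : MType Atom) : A.perp.perp = A := by
  induction A <;> simp_all [MType.perp]

/-- Typing by `m`-types, where a variable has every type. The function type `A^⊥ → B` is written
`A ∨ B`, which by involutivity of negation is the same as in `HasType`. Terms `U ⋆ V`, whose type is
`⊥`, are not typed. -/
inductive HasTy : Term → MType Atom → Prop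
  | var (x : ℕ) (A : MType Atom) : HasTy (var x) A
  | K (A B : MType Atom) : HasTy K (.or A.perp (.or B A))
  | S (A B C : MType Atom) :
      HasTy S (.or (.and A (.and B C.perp)) (.or (.and A B.perp) (.or A.perp C)))
  | C (A B : MType Atom) : HasTy C (.or (.and A B) (.or (.and A B.perp) A.perp))
  | P (A B : MType Atom) : HasTy P (.or A.perp (.or B.perp (.and A B)))
  | Q₁ (A B : MType Atom) : HasTy Q₁ (.or A.perp (.or A B))
  | Q₂ (A B : MType Atom) : HasTy Q₂ (.or B.perp (.or A B))
  | app {A B : MType Atom} {U V : Term} (hU : HasTy U (.or A B)) (hV : HasTy V A.perp) :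
      HasTy (app U V) B

theorem HasTy.app_inv {U V : Term} {B : MType Atom} (h : HasTy (Term.app U V) B) :
    ∃ A, HasTy U (.or A B) ∧ HasTy V A.perp := by
  cases h with
  | app hU hV => exact ⟨_, hU, hV⟩

theorem HasTy.K_inv {T : MType Atom} (h : HasTy Term.K T) :
    ∃ A B, T = .or (MType.perp A) (.or B A) := by
  cases h; exact ⟨_, _, rfl⟩

theorem HasTy.S_inv {T : MType Atom} (h : HasTy Term.S T) :
    ∃ A B C, T = .or (.and A (.and B (MType.perp C)))
      (.or (.and A (MType.perp B)) (.or (MType.perp A) C)) := by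
  cases h; exact ⟨_, _, _, rfl⟩

theorem HasTy.C_inv {T : MType Atom} (h : HasTy Term.C T) :
    ∃ A B, T = .or (.and A B) (.or (.and A (MType.perp B)) (MType.perp A)) := by
  cases h; exact ⟨_, _, rfl⟩

theorem HasTy.K_app_inv {U : Term} {A B : MType Atom} (h : HasTy (Term.app Term.K U) (.or A B)) :
    HasTy U B := by
  obtain ⟨X, hK, hU⟩ := h.app_inv
  obtain ⟨Y, Z, e⟩ := hK.K_inv
  simp only [MType.or.injEq] at e
  obtain ⟨rfl, rfl, rfl⟩ := e
  simpa using hU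

theorem HasTy.I_inv {A B : MType Atom} (h : HasTy I (.or A B)) : A = B.perp := by
  obtain ⟨X, h1, hK⟩ := h.app_inv
  obtain ⟨Y, hS, hK'⟩ := h1.app_inv
  obtain ⟨D, E, F, e⟩ := hS.S_inv
  simp only [MType.or.injEq] at e
  obtain ⟨rfl, rfl, rfl, rfl⟩ := e
  obtain ⟨G, H, e⟩ := hK'.K_inv
  simp only [MType.perp, MType.or.injEq, MType.perp_perp] at e
  obtain ⟨e, -, rfl⟩ := e
  exact e

theorem HasTy.C_app_inv {a b : Term} {T : MType Atom}
    (h : HasTy (Term.app (Term.app Term.C a) b) T) :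
    ∃ A, HasTy a (.or T (MType.perp A)) ∧ HasTy b (.or T A) := by
  obtain ⟨X, h1, hb⟩ := h.app_inv
  obtain ⟨Y, hC, ha⟩ := h1.app_inv
  obtain ⟨A, B, e⟩ := hC.C_inv
  simp only [MType.or.injEq] at e
  obtain ⟨rfl, rfl, rfl⟩ := e
  exact ⟨B, by simpa [MType.perp] using ha, by simpa [MType.perp] using hb⟩

theorem HasTy.P_app_inv {u v : Term} {T : MType Atom}
    (h : HasTy (Term.app (Term.app Term.P u) v) T) : ∃ A B, T = .and A B := by
  obtain ⟨X, h1, -⟩ := h.app_inv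
  obtain ⟨Y, hP, -⟩ := h1.app_inv
  generalize e : MType.or Y (.or X T) = D at hP
  cases hP
  simp only [MType.or.injEq] at e
  exact ⟨_, _, e.2.2⟩

theorem HasTy.Q₁_app_inv {w : Term} {T : MType Atom} (h : HasTy (Term.app Term.Q₁ w) T) :
    ∃ A B, T = .or A B := by
  obtain ⟨X, hQ, -⟩ := h.app_inv
  generalize e : MType.or X T = D at hQ
  cases hQ
  simp only [MType.or.injEq] at e
  exact ⟨_, _, e.2⟩

theorem HasTy.Q₂_app_inv {w : Term} {T : MType Atom} (h : HasTy (Term.app Term.Q₂ w) T) :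
    ∃ A B, T = .or A B := by
  obtain ⟨X, hQ, -⟩ := h.app_inv
  generalize e : MType.or X T = D at hQ
  cases hQ
  simp only [MType.or.injEq] at e
  exact ⟨_, _, e.2⟩

/-! ### Reduction -/

/-- The part of the reduction that acts on terms of `m`-type: the rules that do not mention `⋆`,
closed under application. -/
inductive MRed : Term → Term → Prop
  | k (U V : Term) : MRed (app (app K U) V) U
  | s (U V W : Term) : MRed (app (app (app S U) V) W) (app (app U W) (app V W))
  | e_r (U : Term) : MRed (app (app C (app K U)) I) U
  | e_l (U : Term) : MRed (app (app C I) (app K U)) U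
  | app_left {U U' : Term} (V : Term) (h : MRed U U') : MRed (app U V) (app U' V)
  | app_right (U : Term) {V V' : Term} (h : MRed V V') : MRed (app U V) (app U V')

/-- Reflexive transitive closure of `MRed`. -/
abbrev MReds : Term → Term → Prop := Relation.ReflTransGen MRed

/-- `Sub N T`: `N` is a subterm of `T`. -/
inductive Sub (N : Term) : Term → Prop
  | refl : Sub N N
  | app_left {U V : Term} (h : Sub N U) : Sub N (app U V)
  | app_right {U V : Term} (h : Sub N V) : Sub N (app U V)
  | star_left {U V : Term} (h : Sub N U) : Sub N (star U V)
  | star_right {U V : Term} (h : Sub N V) : Sub N (star U V)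

/-- The term `C (K U) (K V)`. -/
abbrev ckk (U V : Term) : Term := app (app C (app K U)) (app K V)

/-- `PQ U V T`: the term `U ⋆ V` reduces to `T` by one of the rules for `P` and `Q₁`, `Q₂`. -/
inductive PQ : Term → Term → Term → Prop
  | pq₁ (U V W : Term) : PQ (app (app P U) V) (app Q₁ W) (star U W)
  | pq₂ (U V W : Term) : PQ (app (app P U) V) (app Q₂ W) (star V W)
  | qp₁ (U V W : Term) : PQ (app Q₁ W) (app (app P U) V) (star W U)
  | qp₂ (U V W : Term) : PQ (app Q₂ W) (app (app P U) V) (star W V)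

/-- Reduction with escapes: besides `MRed` (at the root or in a component of a root `⋆`) and the
rules for a root `⋆`, every term, of whatever type, reduces to `U ⋆ V` if `C (K U) (K V)` is a
subterm of it. -/
inductive Step : Term → Term → Prop
  | mred {T T' : Term} (h : MRed T T') : Step T T'
  | star_left {U U' : Term} (V : Term) (h : MRed U U') : Step (star U V) (star U' V)
  | star_right (U : Term) {V V' : Term} (h : MRed V V') : Step (star U V) (star U V')
  | c_r (U V W : Term) : Step (star (app (app C U) V) W) (star (app U W) (app V W))
  | c_l (U V W : Term) : Step (star W (app (app C U) V)) (star (app U W) (app V W))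
  | pq {U V T : Term} (h : PQ U V T) : Step (star U V) T
  | escape {T U V : Term} (h : Sub (ckk U V) T) : Step T (star U V)

/-- Strong normalization for `Step`. -/
abbrev SN (T : Term) : Prop := Acc (fun T₂ T₁ : Term => Step T₁ T₂) T

/-- All the terms to which `T` escapes are strongly normalizing. -/
def Esc (T : Term) : Prop := ∀ U V, Sub (ckk U V) T → SN (star U V)

theorem SN.esc {T : Term} (h : SN T) : Esc T := fun _ _ hs => h.inv (.escape hs)

theorem SN.mred {T T' : Term} (h : SN T) (hr : MRed T T') : SN T' := h.inv (.mred hr)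

theorem Esc.app {f a : Term} (hf : Esc f) (ha : Esc a)
    (h : ∀ U V, f = Term.app C (Term.app K U) → a = Term.app K V → SN (star U V)) :
    Esc (Term.app f a) := by
  intro U V hs
  cases hs with
  | refl => exact h U V rfl rfl
  | app_left hs => exact hf _ _ hs
  | app_right hs => exact ha _ _ hs

theorem esc_K : Esc K := fun _ _ h => by cases h
theorem esc_S : Esc S := fun _ _ h => by cases h
theorem esc_C : Esc C := fun _ _ h => by cases h
theorem esc_P : Esc P := fun _ _ h => by cases h
theorem esc_Q₁ : Esc Q₁ := fun _ _ h => by cases h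
theorem esc_Q₂ : Esc Q₂ := fun _ _ h => by cases h

/-- Subject reduction. In the two rules for `C`, the type of `I` forces the type of `U` to be that
of the redex. -/
theorem HasTy.mred {t t' : Term} (hr : MRed t t') : ∀ {A : MType Atom}, HasTy t A → HasTy t' A := by
  induction hr with
  | k U V =>
    intro A h
    obtain ⟨X, h1, -⟩ := h.app_inv
    exact h1.K_app_inv
  | s U V W =>
    intro A h
    obtain ⟨X, h1, hW⟩ := h.app_inv
    obtain ⟨Y, h2, hV⟩ := h1.app_inv
    obtain ⟨Z, h3, hU⟩ := h2.app_inv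
    obtain ⟨D, E, F, e⟩ := h3.S_inv
    simp only [MType.or.injEq] at e
    obtain ⟨rfl, rfl, rfl, rfl⟩ := e
    simp only [MType.perp, MType.perp_perp] at hU hV hW
    exact .app (.app hU (by simpa using hW)) (by simpa using HasTy.app hV (by simpa using hW))
  | e_r U =>
    intro A h
    obtain ⟨B, ha, hb⟩ := h.C_app_inv
    rw [hb.I_inv]
    exact ha.K_app_inv
  | e_l U =>
    intro A h
    obtain ⟨B, ha, hb⟩ := h.C_app_inv
    have := ha.I_inv
    rw [MType.perp_perp] at this
    rw [this]
    exact hb.K_app_inv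
  | app_left V _ ih =>
    intro A h
    obtain ⟨X, h1, h2⟩ := h.app_inv
    exact .app (ih h1) h2
  | app_right U _ ih =>
    intro A h
    obtain ⟨X, h1, h2⟩ := h.app_inv
    exact .app h1 (ih h2)

/-- Strong normalization passes from `f a` to `f`; typability of `f` excludes that `f` is a `⋆`. -/
theorem SN.of_app {f a : Term} {A : MType Atom} (h : SN (Term.app f a)) (hf : HasTy f A) :
    SN f := by
  generalize e : Term.app f a = t at h
  induction h generalizing f with
  | intro t hacc ih =>
    subst e
    refine Acc.intro _ fun t' hs => ?_
    cases hs with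
    | mred hr => exact ih _ (.mred (.app_left _ hr)) (hf.mred hr) rfl
    | escape hs => exact hacc _ (.escape (.app_left hs))
    | _ => cases hf

/-! ### Partially applied combinators -/

/-- `Val t`: `t` is a combinator applied to fewer arguments than its rules or its role as a
constructor (for `P`, `Q₁`, `Q₂` and `C`) ask for. -/
inductive Val : Term → Prop
  | K : Val K
  | K₁ (a : Term) : Val (app K a)
  | S : Val S
  | S₁ (a : Term) : Val (app S a)
  | S₂ (a b : Term) : Val (app (app S a) b)
  | C : Val C
  | C₁ (a : Term) : Val (app C a)
  | P : Val P
  | P₁ (a : Term) : Val (app P a)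
  | Q₁ : Val Q₁
  | Q₂ : Val Q₂

theorem Val.mred {t t' : Term} (hv : Val t) (h : MRed t t') : Val t' := by
  cases hv with
  | S₂ a b =>
    cases h with
    | app_left _ h =>
      cases h with
      | app_left _ h => cases h
      | app_right _ h => exact .S₂ _ _
    | app_right _ h => exact .S₂ _ _
  | K₁ a =>
    cases h with
    | app_left _ h => cases h
    | app_right _ h => exact .K₁ _
  | S₁ a =>
    cases h with
    | app_left _ h => cases h
    | app_right _ h => exact .S₁ _
  | C₁ a =>
    cases h with
    | app_left _ h => cases h
    | app_right _ h => exact .C₁ _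
  | P₁ a =>
    cases h with
    | app_left _ h => cases h
    | app_right _ h => exact .P₁ _
  | _ => cases h

theorem Val.mreds {t t' : Term} (hv : Val t) (h : MReds t t') : Val t' := by
  induction h with
  | refl => exact hv
  | tail _ h ih => exact ih.mred h

theorem not_val_app {t u : Term} (h : ¬ Val t) : ¬ Val (app t u) := by
  intro hv
  cases hv <;> exact h (by constructor)

/-! ### The interpretation of types -/

/-- The terms that satisfy `Φ`, and such that `a u ⋆ b u` is strongly normalizing for all `u ∈ Y`
whenever they reduce to `C a b`. -/
def constrain (Φ : Term → Prop) (Y : Set Term) : Set Term :=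
  {t | Φ t ∧ ∀ a b, MReds t (app (app C a) b) → ∀ u ∈ Y, SN (star (app a u) (app b u))}

theorem constrain_antitone (Φ : Term → Prop) : Antitone (constrain Φ) :=
  fun _ _ h _ ht => ⟨ht.1, fun a b hr u hu => ht.2 a b hr u (h hu)⟩

/-- A solution `(X, Y)` of `X = constrain Φ Y` and `Y = constrain Ψ X`. -/
def pair (Φ Ψ : Term → Prop) : Set Term × Set Term :=
  let X := OrderHom.lfp (⟨fun X => constrain Φ (constrain Ψ X),
    (constrain_antitone Φ).comp (constrain_antitone Ψ)⟩ : Set Term →o Set Term)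
  (X, constrain Ψ X)

theorem pair_fst (Φ Ψ : Term → Prop) : (pair Φ Ψ).1 = constrain Φ (pair Φ Ψ).2 :=
  (OrderHom.map_lfp (⟨fun X => constrain Φ (constrain Ψ X),
    (constrain_antitone Φ).comp (constrain_antitone Ψ)⟩ : Set Term →o Set Term)).symm

theorem pair_snd (Φ Ψ : Term → Prop) : (pair Φ Ψ).2 = constrain Ψ (pair Φ Ψ).1 := rfl

/-- The condition on members of the interpretation of `A ∨ B` that does not refer to the
interpretation of the negation, given those of `A` and `B` with those of their negations. -/
def OrCond (A B : MType Atom) (X Y : Set Term × Set Term) (t : Term) : Prop :=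
  HasTy t (.or A B) ∧ SN t ∧ (∀ w, MReds t (app Q₁ w) → w ∈ X.1) ∧
    (∀ w, MReds t (app Q₂ w) → w ∈ Y.1) ∧ ∀ u ∈ X.2, app t u ∈ Y.1

/-- The analogue of `OrCond` for a conjunction. -/
def AndCond (A B : MType Atom) (X Y : Set Term × Set Term) (t : Term) : Prop :=
  HasTy t (.and A B) ∧ SN t ∧ ∀ u v, MReds t (app (app P u) v) → u ∈ X.1 ∧ v ∈ Y.1

/-- The interpretations of `A` and of `A^⊥`, defined together. -/
def cand : MType Atom → Set Term × Set Term
  | .pos a => pair (fun t => HasTy t (.pos a) ∧ SN t) (fun t => HasTy t (.neg a) ∧ SN t)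
  | .neg a => (pair (fun t => HasTy t (.pos a) ∧ SN t) (fun t => HasTy t (.neg a) ∧ SN t)).swap
  | .or A B => pair (OrCond A B (cand A) (cand B))
      (AndCond A.perp B.perp (cand A).swap (cand B).swap)
  | .and A B => (pair (OrCond A.perp B.perp (cand A).swap (cand B).swap)
      (AndCond A B (cand A) (cand B))).swap

theorem cand_perp (A : MType Atom) : cand A.perp = (cand A).swap := by
  induction A with
  | pos a => rfl
  | neg a => simp [MType.perp, cand]
  | and A B ihA ihB => simp [MType.perp, cand, ihA, ihB]
  | or A B ihA ihB => simp [MType.perp, cand, ihA, ihB]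

/-- The interpretation `⟪A⟫` of an `m`-type: the reducible terms of type `A`. -/
def interp (A : MType Atom) : Set Term := (cand A).1

local notation "⟪" A "⟫" => interp A

theorem cand_snd (A : MType Atom) : (cand A).2 = ⟪A.perp⟫ := by
  simp [interp, cand_perp]

/-- The conditions on a member of `⟪A⟫` of one of the forms `P u v`, `Q₁ w`, `Q₂ w`, `C a b`. -/
structure Canon (A : MType Atom) (t : Term) : Prop where
  P : ∀ X Y u v, A = .and X Y → t = app (app P u) v → u ∈ ⟪X⟫ ∧ v ∈ ⟪Y⟫
  Q₁ : ∀ X Y w, A = .or X Y → t = app Q₁ w → w ∈ ⟪X⟫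
  Q₂ : ∀ X Y w, A = .or X Y → t = app Q₂ w → w ∈ ⟪Y⟫
  C : ∀ a b, t = app (app C a) b → ∀ u ∈ ⟪A.perp⟫, SN (star (app a u) (app b u))

/-- The fixed point equation for `⟪A⟫`, uniformly in `A`. -/
theorem mem_interp {A : MType Atom} {t : Term} : t ∈ ⟪A⟫ ↔ HasTy t A ∧ SN t ∧
    (∀ t', MReds t t' → Canon A t') ∧
    ∀ X Y, A = .or X Y → ∀ u ∈ ⟪X.perp⟫, app t u ∈ ⟪Y⟫ := by
  have key : ∀ Φ : Term → Prop, (cand A).1 = constrain Φ (cand A).2 →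
      (t ∈ ⟪A⟫ ↔ Φ t ∧ ∀ a b, MReds t (app (app Term.C a) b) →
        ∀ u ∈ ⟪A.perp⟫, SN (star (app a u) (app b u))) := by
    intro Φ h
    rw [interp, h, cand_snd]
    rfl
  cases A with
  | pos a =>
    rw [key _ (pair_fst _ _)]
    constructor
    · rintro ⟨⟨h1, h2⟩, h3⟩
      exact ⟨h1, h2, fun t' hr => ⟨nofun, nofun, nofun, fun a b e => h3 a b (e ▸ hr)⟩, nofun⟩
    · rintro ⟨h1, h2, h3, -⟩
      exact ⟨⟨h1, h2⟩, fun a b hr => (h3 _ hr).C a b rfl⟩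
  | neg a =>
    rw [key _ (pair_snd _ _)]
    constructor
    · rintro ⟨⟨h1, h2⟩, h3⟩
      exact ⟨h1, h2, fun t' hr => ⟨nofun, nofun, nofun, fun a b e => h3 a b (e ▸ hr)⟩, nofun⟩
    · rintro ⟨h1, h2, h3, -⟩
      exact ⟨⟨h1, h2⟩, fun a b hr => (h3 _ hr).C a b rfl⟩
  | and A B =>
    rw [key _ (pair_snd _ _)]
    constructor
    · rintro ⟨⟨h1, h2, h4⟩, h3⟩
      refine ⟨h1, h2, fun t' hr => ⟨?_, nofun, nofun, fun a b e => h3 a b (e ▸ hr)⟩, nofun⟩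
      rintro X Y u v e rfl
      cases e
      exact h4 u v hr
    · rintro ⟨h1, h2, h3, -⟩
      exact ⟨⟨h1, h2, fun u v hr => (h3 _ hr).P _ _ u v rfl rfl⟩,
        fun a b hr => (h3 _ hr).C a b rfl⟩
  | or A B =>
    rw [key _ (pair_fst _ _)]
    constructor
    · rintro ⟨⟨h1, h2, h4, h5, h6⟩, h3⟩
      refine ⟨h1, h2, fun t' hr => ⟨nofun, ?_, ?_, fun a b e => h3 a b (e ▸ hr)⟩, ?_⟩
      · rintro X Y w e rfl
        cases e
        exact h4 w hr
      · rintro X Y w e rfl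
        cases e
        exact h5 w hr
      · rintro X Y e
        cases e
        rw [cand_snd] at h6
        exact h6
    · rintro ⟨h1, h2, h3, h6⟩
      refine ⟨⟨h1, h2, fun w hr => (h3 _ hr).Q₁ _ _ w rfl rfl,
        fun w hr => (h3 _ hr).Q₂ _ _ w rfl rfl, ?_⟩, fun a b hr => (h3 _ hr).C a b rfl⟩
      rw [cand_snd]
      exact h6 _ _ rfl

section

variable {A B : MType Atom} {t : Term}

theorem hasTy_of_mem (h : t ∈ ⟪A⟫) : HasTy t A := (mem_interp.1 h).1

theorem sn_of_mem (h : t ∈ ⟪A⟫) : SN t := (mem_interp.1 h).2.1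

theorem esc_of_mem (h : t ∈ ⟪A⟫) : Esc t := (sn_of_mem h).esc

theorem canon_of_mem (h : t ∈ ⟪A⟫) : Canon A t := (mem_interp.1 h).2.2.1 t .refl

theorem app_mem {u : Term} (h : t ∈ ⟪.or A B⟫) (hu : u ∈ ⟪A.perp⟫) : app t u ∈ ⟪B⟫ :=
  (mem_interp.1 h).2.2.2 A B rfl u hu

end

theorem mem_of_mred {A : MType Atom} : ∀ {t t' : Term}, t ∈ ⟪A⟫ → MRed t t' → t' ∈ ⟪A⟫ := by
  induction A with
  | or A B ihA ihB =>
    intro t t' h hr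
    obtain ⟨h1, h2, h3, h4⟩ := mem_interp.1 h
    refine mem_interp.2 ⟨h1.mred hr, h2.mred hr, fun s hs => h3 s (.head hr hs), ?_⟩
    rintro X Y e
    cases e
    exact fun u hu => ihB (app_mem h hu) (.app_left _ hr)
  | _ =>
    intro t t' h hr
    obtain ⟨h1, h2, h3, h4⟩ := mem_interp.1 h
    exact mem_interp.2 ⟨h1.mred hr, h2.mred hr, fun s hs => h3 s (.head hr hs), nofun⟩

/-- Induction along reductions inside a candidate. -/
theorem interp_induction {A : MType Atom} {p : Term → Prop}
    (h : ∀ t ∈ ⟪A⟫, (∀ t', MRed t t' → p t') → p t) {t : Term} (ht : t ∈ ⟪A⟫) : p t := by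
  have hs := sn_of_mem ht
  induction hs with
  | intro t _ ih => exact h t ht fun t' hr => ih t' (.mred hr) (mem_of_mred ht hr)

/-- `P u v`, `Q₁ w`, `Q₂ w` and `C a b` apply a partially applied combinator, so the conditions of
`Canon` are void for other applications. -/
theorem canon_app {A : MType Atom} {t u : Term} (hv : ¬ Val t) : Canon A (app t u) := by
  constructor
  · rintro X Y u v - e
    cases e
    exact (hv (.P₁ _)).elim
  · rintro X Y w - e
    cases e
    exact (hv .Q₁).elim
  · rintro X Y w - e
    cases e
    exact (hv .Q₂).elim
  · rintro a b e
    cases e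
    exact (hv (.C₁ _)).elim

/-- A typed term that is not a partially applied combinator is reducible as soon as its reducts are,
its escapes are strongly normalizing, and it meets the conditions on `P u v`, `Q₁ w`, `Q₂ w`
and `C a b`. -/
theorem mem_interp_of_reducts {A : MType Atom} : ∀ {t : Term}, ¬ Val t → HasTy t A → Esc t →
    (∀ t', MRed t t' → t' ∈ ⟪A⟫) → Canon A t → t ∈ ⟪A⟫ := by
  have sn : ∀ {A : MType Atom} {t : Term}, HasTy t A → Esc t →
      (∀ t', MRed t t' → t' ∈ ⟪A⟫) → SN t := by
    intro A t ht he hr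
    refine Acc.intro _ fun t' hs => ?_
    cases hs with
    | mred h => exact sn_of_mem (hr _ h)
    | escape h => exact he _ _ h
    | _ => cases ht
  have canon : ∀ {A : MType Atom} {t : Term}, (∀ t', MRed t t' → t' ∈ ⟪A⟫) → Canon A t →
      ∀ t', MReds t t' → Canon A t' := by
    intro A t hr hc t' h
    obtain rfl | ⟨s, h1, h2⟩ := h.cases_head
    · exact hc
    · exact (mem_interp.1 (hr _ h1)).2.2.1 _ h2
  induction A with
  | or A B ihA ihB =>
    intro t hv ht he hr hc
    refine mem_interp.2 ⟨ht, sn ht he hr, canon hr hc, ?_⟩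
    rintro X Y e u hu
    cases e
    -- `t u` is neither partial nor a canonical form, since `t` is not partial
    refine interp_induction (p := fun u => app t u ∈ ⟪B⟫) (fun u hu ih => ?_) hu
    refine ihB (not_val_app hv) (.app ht (hasTy_of_mem hu)) ?_ ?_ (canon_app hv)
    · refine he.app (esc_of_mem hu) ?_
      rintro U V rfl
      exact (hv (.C₁ _)).elim
    · intro t' h
      cases h with
      | app_left _ h => exact app_mem (hr _ h) hu
      | app_right _ h => exact ih _ h
      | k => exact (hv (.K₁ _)).elim
      | s => exact (hv (.S₂ _ _)).elim
      | e_r => exact (hv (.C₁ _)).elim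
      | e_l => exact (hv (.C₁ _)).elim
  | _ =>
    intro t hv ht he hr hc
    exact mem_interp.2 ⟨ht, sn ht he hr, canon hr hc, nofun⟩

theorem var_mem (x : ℕ) (A : MType Atom) : var x ∈ ⟪A⟫ :=
  mem_interp_of_reducts nofun (.var x A) nofun nofun ⟨nofun, nofun, nofun, nofun⟩

/-- A partially applied combinator is reducible as soon as its values are: strong normalization is
read off its value at a variable. -/
theorem Val.mem {A B : MType Atom} {t : Term} (hv : Val t) (ht : HasTy t (.or A B))
    (h : ∀ u ∈ ⟪A.perp⟫, app t u ∈ ⟪B⟫) : t ∈ ⟪.or A B⟫ := by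
  refine mem_interp.2 ⟨ht, (sn_of_mem (h _ (var_mem 0 _))).of_app ht, fun t' hr => ?_, ?_⟩
  · have hv' := hv.mreds hr
    constructor
    · exact nofun
    · rintro _ _ _ - rfl
      cases hv'
    · rintro _ _ _ - rfl
      cases hv'
    · rintro _ _ rfl
      cases hv'
  · rintro X Y e
    cases e
    exact h

/-- If `K U` is reducible then so is `U`, because `K U x` is a reducible term for a variable `x`. -/
theorem mem_of_K_app_mem {A B : MType Atom} {U : Term} (h : app K U ∈ ⟪.or A B⟫) : U ∈ ⟪B⟫ :=
  mem_of_mred (app_mem h (var_mem 0 _)) (.k _ _)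

/-! ### Orthogonality -/

/-- Orthogonality for `A`, provided that the contracta of the rules for `P`, `Q₁` and `Q₂` are
strongly normalizing: the contracta of the rules for `C` are so by the definition of `⟪A⟫`
and `⟪A^⊥⟫`, and an escape is an escape of one of the two components. -/
theorem sn_star_of_PQ {A : MType Atom}
    (h : ∀ u ∈ ⟪A⟫, ∀ v ∈ ⟪A.perp⟫, ∀ t, PQ u v t ∨ PQ v u t → SN t)
    {u v : Term} (hu : u ∈ ⟪A⟫) (hv : v ∈ ⟪A.perp⟫) : SN (star u v) ∧ SN (star v u) := by
  revert v
  refine interp_induction (p := fun u => ∀ {v}, v ∈ ⟪A.perp⟫ → SN (star u v) ∧ SN (star v u))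
    (fun u hu ihu v hv => ?_) hu
  refine interp_induction (p := fun v => SN (star u v) ∧ SN (star v u)) (fun v hv ihv => ?_) hv
  have hC := (canon_of_mem hu).C
  have hC' := (canon_of_mem hv).C
  rw [MType.perp_perp] at hC'
  constructor
  · refine Acc.intro _ fun t hs => ?_
    cases hs with
    | mred hs => cases hs
    | star_left _ hs => exact (ihu _ hs hv).1
    | star_right _ hs => exact (ihv _ hs).1
    | c_r a b => exact hC a b rfl _ hv
    | c_l a b => exact hC' a b rfl _ hu
    | pq hs => exact h u hu v hv t (.inl hs)
    | escape hs =>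
      cases hs with
      | star_left hs => exact esc_of_mem hu _ _ hs
      | star_right hs => exact esc_of_mem hv _ _ hs
  · refine Acc.intro _ fun t hs => ?_
    cases hs with
    | mred hs => cases hs
    | star_left _ hs => exact (ihv _ hs).2
    | star_right _ hs => exact (ihu _ hs hv).2
    | c_r a b => exact hC' a b rfl _ hu
    | c_l a b => exact hC a b rfl _ hv
    | pq hs => exact h u hu v hv t (.inr hs)
    | escape hs =>
      cases hs with
      | star_left hs => exact esc_of_mem hv _ _ hs
      | star_right hs => exact esc_of_mem hu _ _ hs

/-- Reducible terms of dual types may be put against each other, in both orders. -/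
theorem sn_star_of_mem {A : MType Atom} : ∀ {u v : Term}, u ∈ ⟪A⟫ → v ∈ ⟪A.perp⟫ →
    SN (star u v) ∧ SN (star v u) := by
  have atom : ∀ {A : MType Atom}, (¬ ∃ X Y, A = .and X Y) → (¬ ∃ X Y, A = .or X Y) →
      ∀ {u v t : Term}, u ∈ ⟪A⟫ → PQ u v t ∨ PQ v u t → False := by
    intro A h1 h2 u v t hu h
    have hu := hasTy_of_mem hu
    rcases h with h | h <;> cases h
    all_goals first
      | exact h1 hu.P_app_inv
      | exact h2 hu.Q₁_app_inv
      | exact h2 hu.Q₂_app_inv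
  induction A with
  | pos a =>
    exact sn_star_of_PQ fun u hu v _ t h =>
      (atom (by simp) (by simp) hu h).elim
  | neg a =>
    exact sn_star_of_PQ fun u hu v _ t h =>
      (atom (by simp) (by simp) hu h).elim
  | and X Y ihX ihY =>
    refine fun {_ _} => sn_star_of_PQ fun u hu v hv t h => ?_
    have hcu := canon_of_mem hu
    have hcv := canon_of_mem hv
    have hu := hasTy_of_mem hu
    rcases h with h | h <;> cases h
    case inl.pq₁ => exact (ihX (hcu.P _ _ _ _ rfl rfl).1 (hcv.Q₁ _ _ _ rfl rfl)).1
    case inl.pq₂ => exact (ihY (hcu.P _ _ _ _ rfl rfl).2 (hcv.Q₂ _ _ _ rfl rfl)).1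
    case inr.qp₁ => exact (ihX (hcu.P _ _ _ _ rfl rfl).1 (hcv.Q₁ _ _ _ rfl rfl)).2
    case inr.qp₂ => exact (ihY (hcu.P _ _ _ _ rfl rfl).2 (hcv.Q₂ _ _ _ rfl rfl)).2
    all_goals first
      | (obtain ⟨_, _, e⟩ := hu.Q₁_app_inv; cases e)
      | (obtain ⟨_, _, e⟩ := hu.Q₂_app_inv; cases e)
  | or X Y ihX ihY =>
    refine fun {_ _} => sn_star_of_PQ fun u hu v hv t h => ?_
    have hcu := canon_of_mem hu
    have hcv := canon_of_mem hv
    have hu := hasTy_of_mem hu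
    rcases h with h | h <;> cases h
    case inl.qp₁ => exact (ihX (hcu.Q₁ _ _ _ rfl rfl) (hcv.P _ _ _ _ rfl rfl).1).1
    case inl.qp₂ => exact (ihY (hcu.Q₂ _ _ _ rfl rfl) (hcv.P _ _ _ _ rfl rfl).2).1
    case inr.pq₁ => exact (ihX (hcu.Q₁ _ _ _ rfl rfl) (hcv.P _ _ _ _ rfl rfl).1).2
    case inr.pq₂ => exact (ihY (hcu.Q₂ _ _ _ rfl rfl) (hcv.P _ _ _ _ rfl rfl).2).2
    all_goals (obtain ⟨_, _, e⟩ := hu.P_app_inv; cases e)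

/-! ### The combinators are reducible -/

section

variable {A B D : MType Atom} {a b c : Term}

theorem K_app_app_mem (ha : a ∈ ⟪A⟫) (hb : b ∈ ⟪B.perp⟫) : app (app K a) b ∈ ⟪A⟫ := by
  revert b
  refine interp_induction (p := fun a => ∀ {b}, b ∈ ⟪B.perp⟫ → app (app K a) b ∈ ⟪A⟫)
    (fun a ha iha b hb => ?_) ha
  refine interp_induction (p := fun b => app (app K a) b ∈ ⟪A⟫) (fun b hb ihb => ?_) hb
  refine mem_interp_of_reducts nofun
    (.app (.app (.K A B) (by simpa using hasTy_of_mem ha)) (hasTy_of_mem hb))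
    ((esc_K.app (esc_of_mem ha) nofun).app (esc_of_mem hb) nofun) (fun t h => ?_)
    ⟨nofun, nofun, nofun, nofun⟩
  cases h with
  | k => exact ha
  | app_left _ h =>
    cases h with
    | app_left _ h => cases h
    | app_right _ h => exact iha _ h hb
  | app_right _ h => exact ihb _ h

theorem S_app_app_hasTy (ha : HasTy a (.or A (.or B D))) (hb : HasTy b (.or A B.perp)) :
    HasTy (app (app S a) b) (.or A D) := by
  have := HasTy.S A.perp B.perp D
  rw [A.perp_perp] at this
  exact .app (.app this (by simpa [MType.perp] using ha)) (by simpa [MType.perp] using hb)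

theorem S_app_app_app_mem (ha : a ∈ ⟪.or A (.or B D)⟫) (hb : b ∈ ⟪.or A B.perp⟫)
    (hc : c ∈ ⟪A.perp⟫) : app (app (app S a) b) c ∈ ⟪D⟫ := by
  revert b c
  refine interp_induction (p := fun a => ∀ {b c}, b ∈ ⟪.or A B.perp⟫ → c ∈ ⟪A.perp⟫ →
    app (app (app S a) b) c ∈ ⟪D⟫) (fun a ha iha b c hb hc => ?_) ha
  revert c
  refine interp_induction (p := fun b => ∀ c ∈ ⟪A.perp⟫,
    app (app (app S a) b) c ∈ ⟪D⟫) (fun b hb ihb c hc => ?_) hb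
  refine interp_induction (p := fun c => app (app (app S a) b) c ∈ ⟪D⟫) (fun c hc ihc => ?_) hc
  refine mem_interp_of_reducts nofun
    (.app (S_app_app_hasTy (hasTy_of_mem ha) (hasTy_of_mem hb)) (hasTy_of_mem hc))
    (((esc_S.app (esc_of_mem ha) nofun).app (esc_of_mem hb) nofun).app (esc_of_mem hc) nofun)
    (fun t h => ?_) ⟨nofun, nofun, nofun, nofun⟩
  cases h with
  | s => exact app_mem (app_mem ha hc) (app_mem hb hc)
  | app_left _ h =>
    cases h with
    | app_left _ h =>
      cases h with
      | app_left _ h => cases h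
      | app_right _ h => exact iha _ h hb hc
    | app_right _ h => exact ihb _ h _ hc
  | app_right _ h => exact ihc _ h

theorem P_app_app_mem (ha : a ∈ ⟪A⟫) (hb : b ∈ ⟪B⟫) : app (app P a) b ∈ ⟪.and A B⟫ := by
  revert b
  refine interp_induction (p := fun a => ∀ {b}, b ∈ ⟪B⟫ → app (app P a) b ∈ ⟪.and A B⟫)
    (fun a ha iha b hb => ?_) ha
  refine interp_induction (p := fun b => app (app P a) b ∈ ⟪.and A B⟫) (fun b hb ihb => ?_) hb
  refine mem_interp_of_reducts nofun
    (.app (.app (.P A B) (by simpa using hasTy_of_mem ha)) (by simpa using hasTy_of_mem hb))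
    ((esc_P.app (esc_of_mem ha) nofun).app (esc_of_mem hb) nofun) (fun t h => ?_)
    ⟨?_, nofun, nofun, nofun⟩
  · cases h with
    | app_left _ h =>
      cases h with
      | app_left _ h => cases h
      | app_right _ h => exact iha _ h hb
    | app_right _ h => exact ihb _ h
  · rintro X Y u v e e'
    cases e
    cases e'
    exact ⟨ha, hb⟩

theorem Q₁_app_mem (ha : a ∈ ⟪A⟫) : app Q₁ a ∈ ⟪.or A B⟫ := by
  refine interp_induction (p := fun a => app Q₁ a ∈ ⟪.or A B⟫) (fun a ha iha => ?_) ha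
  refine mem_interp_of_reducts nofun (.app (.Q₁ A B) (by simpa using hasTy_of_mem ha))
    (esc_Q₁.app (esc_of_mem ha) nofun) (fun t h => ?_) ⟨nofun, ?_, nofun, nofun⟩
  · cases h with
    | app_left _ h => cases h
    | app_right _ h => exact iha _ h
  · rintro X Y w e e'
    cases e
    cases e'
    exact ha

theorem Q₂_app_mem (hb : b ∈ ⟪B⟫) : app Q₂ b ∈ ⟪.or A B⟫ := by
  refine interp_induction (p := fun b => app Q₂ b ∈ ⟪.or A B⟫) (fun b hb ihb => ?_) hb
  refine mem_interp_of_reducts nofun (.app (.Q₂ A B) (by simpa using hasTy_of_mem hb))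
    (esc_Q₂.app (esc_of_mem hb) nofun) (fun t h => ?_) ⟨nofun, nofun, ?_, nofun⟩
  · cases h with
    | app_left _ h => cases h
    | app_right _ h => exact ihb _ h
  · rintro X Y w e e'
    cases e
    cases e'
    exact hb

/-- The rules with a `C` at the head are those that need the types: the two `η`-like ones contract
to a term of type `B^⊥` or `B`, which typing of `I` identifies with `A`, and the escape to `U ⋆ V`
opposes reducible terms of types `B^⊥` and `B`. -/
theorem C_app_app_mem (ha : a ∈ ⟪.or A B.perp⟫) (hb : b ∈ ⟪.or A B⟫) :
    app (app C a) b ∈ ⟪A⟫ := by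
  revert b
  refine interp_induction (p := fun a => ∀ {b}, b ∈ ⟪.or A B⟫ → app (app C a) b ∈ ⟪A⟫)
    (fun a ha iha b hb => ?_) ha
  refine interp_induction (p := fun b => app (app C a) b ∈ ⟪A⟫) (fun b hb ihb => ?_) hb
  have hC := HasTy.C A.perp B
  rw [A.perp_perp] at hC
  refine mem_interp_of_reducts nofun
    (.app (.app hC (by simpa [MType.perp] using hasTy_of_mem ha))
      (by simpa [MType.perp] using hasTy_of_mem hb))
    ((esc_C.app (esc_of_mem ha) nofun).app (esc_of_mem hb) ?_) (fun t h => ?_)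
    ⟨nofun, nofun, nofun, ?_⟩
  · intro U V e e'
    cases e
    cases e'
    exact (sn_star_of_mem (mem_of_K_app_mem hb) (mem_of_K_app_mem ha)).2
  · cases h with
    | e_r =>
      rw [(hasTy_of_mem hb).I_inv]
      exact mem_of_K_app_mem ha
    | e_l =>
      have h := (hasTy_of_mem ha).I_inv
      rw [B.perp_perp] at h
      rw [h]
      exact mem_of_K_app_mem hb
    | app_left _ h =>
      cases h with
      | app_left _ h => cases h
      | app_right _ h => exact iha _ h hb
    | app_right _ h => exact ihb _ h
  · intro a' b' e u hu
    cases e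
    exact (sn_star_of_mem (app_mem hb hu) (app_mem ha hu)).2

end

/-- Adequacy: typed terms are reducible. -/
theorem HasTy.mem_interp {t : Term} {A : MType Atom} (h : HasTy t A) : t ∈ ⟪A⟫ := by
  induction h with
  | var x A => exact var_mem x A
  | K A B =>
    refine Val.K.mem (.K A B) fun a ha => ?_
    have hta := HasTy.app (.K A B) (hasTy_of_mem ha)
    rw [A.perp_perp] at ha
    exact (Val.K₁ a).mem hta fun b hb => K_app_app_mem ha hb
  | S A B D =>
    refine Val.S.mem (.S A B D) fun a ha => ?_
    have hta := HasTy.app (.S A B D) (hasTy_of_mem ha)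
    refine (Val.S₁ a).mem hta fun b hb => ?_
    have htb := HasTy.app hta (hasTy_of_mem hb)
    simp only [MType.perp, MType.perp_perp] at ha hb
    exact (Val.S₂ a b).mem htb fun c hc => S_app_app_app_mem ha (by simpa using hb) hc
  | C A B =>
    refine Val.C.mem (.C A B) fun a ha => ?_
    have hta := HasTy.app (.C A B) (hasTy_of_mem ha)
    refine (Val.C₁ a).mem hta fun b hb => ?_
    simp only [MType.perp, MType.perp_perp] at ha hb
    exact C_app_app_mem ha hb
  | P A B =>
    refine Val.P.mem (.P A B) fun a ha => ?_
    have hta := HasTy.app (.P A B) (hasTy_of_mem ha)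
    refine (Val.P₁ a).mem hta fun b hb => ?_
    rw [MType.perp_perp] at ha hb
    exact P_app_app_mem ha hb
  | Q₁ A B =>
    refine Val.Q₁.mem (.Q₁ A B) fun a ha => ?_
    rw [MType.perp_perp] at ha
    exact Q₁_app_mem ha
  | Q₂ A B =>
    refine Val.Q₂.mem (.Q₂ A B) fun b hb => ?_
    rw [MType.perp_perp] at hb
    exact Q₂_app_mem hb
  | app _ _ ihU ihV => exact app_mem ihU ihV

/-! ### The reduction of the calculus -/

/-- The term has no subterm of the form `U ⋆ V`. -/
def StarFree : Term → Prop
  | app U V => StarFree U ∧ StarFree V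
  | Term.star _ _ => False
  | _ => True

theorem Sub.starFree {N T : Term} (h : Sub N T) (hT : StarFree T) : StarFree N := by
  induction h with
  | refl => exact hT
  | app_left _ ih => exact ih hT.1
  | app_right _ ih => exact ih hT.2
  | _ => exact hT.elim

theorem sub_subst {x : ℕ} {N W : Term} (h : Occurs x W) : Sub N (subst x N W) := by
  induction W with
  | var y =>
    obtain rfl : x = y := h
    simpa [subst] using Sub.refl
  | app U V ihU ihV => exact h.elim (fun h => .app_left (ihU h)) fun h => .app_right (ihV h)
  | star U V ihU ihV => exact h.elim (fun h => .star_left (ihU h)) fun h => .star_right (ihV h)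
  | _ => exact h.elim

/-- A typed term of type `⊥` is a `⋆`. -/
theorem HasType.exists_eq_star {Γ : Ctx Atom} {W : Term} (h : HasType Γ W .bot) :
    ∃ U V, W = Term.star U V := by
  cases h with
  | star A U V => exact ⟨U, V, rfl⟩

theorem HasType.hasTy {Γ : Ctx Atom} {T : Term} {D : Ty Atom} (h : HasType Γ T D) :
    ∀ {A : MType Atom}, D = .m A → HasTy T A := by
  induction h with
  | app A B U V _ _ ihU ihV =>
    rintro _ ⟨⟩
    exact .app (ihU rfl) (by simpa using ihV rfl)
  | star => exact nofun
  | _ =>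
    rintro _ ⟨⟩
    constructor

theorem HasTy.starFree {T : Term} {A : MType Atom} (h : HasTy T A) : StarFree T := by
  induction h with
  | app _ _ ihU ihV => exact ⟨ihU, ihV⟩
  | _ => trivial

/-- The rule `simp` does not apply to terms without `⋆`. -/
theorem Red.mred {T T' : Term} (h : Red Atom T T') (hT : StarFree T) : MRed T T' := by
  induction h with
  | k => exact .k _ _
  | s => exact .s _ _ _
  | e_r => exact .e_r _
  | e_l => exact .e_l _
  | simp W U V x hW hx =>
    obtain ⟨Γ, hW⟩ := hW
    obtain ⟨W₁, W₂, rfl⟩ := hW.exists_eq_star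
    exact hT.elim
  | app_left V _ ih => exact .app_left _ (ih hT.1)
  | app_right U _ ih => exact .app_right _ (ih hT.2)
  | _ => exact hT.elim

theorem MRed.starFree {T T' : Term} (h : MRed T T') (hT : StarFree T) : StarFree T' := by
  induction h with
  | k => exact hT.1.2
  | s => exact ⟨⟨hT.1.1.2, hT.2⟩, hT.1.2, hT.2⟩
  | e_r => exact hT.1.2.2
  | e_l => exact hT.2.2
  | app_left V _ ih => exact ⟨ih hT.1, hT.2⟩
  | app_right U _ ih => exact ⟨hT.1, ih hT.2⟩

theorem SN.stronglyNormalizing_of_starFree {T : Term} (h : SN T) (hT : StarFree T) :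
    StronglyNormalizing Atom T := by
  induction h with
  | intro T _ ih =>
    refine Acc.intro _ fun T' hr => ?_
    have hm := Red.mred hr hT
    exact ih T' (.mred hm) (hm.starFree hT)

/-- A reduction of `U ⋆ V`, where `⋆` does not occur in `U` and `V`, is a step, and the reduct is of
the same form. -/
theorem Red.step_star {U V T : Term} (h : Red Atom (Term.star U V) T) (hU : StarFree U)
    (hV : StarFree V) : Step (Term.star U V) T ∧
      ∃ U' V', T = Term.star U' V' ∧ StarFree U' ∧ StarFree V' := by
  generalize e : Term.star U V = X at h
  cases h with
  | c_r U₁ V₁ W =>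
    cases e
    exact ⟨.c_r _ _ _, _, _, rfl, ⟨hU.1.2, hV⟩, hU.2, hV⟩
  | c_l U₁ V₁ W =>
    cases e
    exact ⟨.c_l _ _ _, _, _, rfl, ⟨hV.1.2, hU⟩, hV.2, hU⟩
  | pq₁ =>
    cases e
    exact ⟨.pq (.pq₁ _ _ _), _, _, rfl, hU.1.2, hV.2⟩
  | pq₂ =>
    cases e
    exact ⟨.pq (.pq₂ _ _ _), _, _, rfl, hU.2, hV.2⟩
  | qp₁ =>
    cases e
    exact ⟨.pq (.qp₁ _ _ _), _, _, rfl, hU.2, hV.1.2⟩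
  | qp₂ =>
    cases e
    exact ⟨.pq (.qp₂ _ _ _), _, _, rfl, hU.2, hV.2⟩
  | star_left _ h =>
    cases e
    have hm := h.mred hU
    exact ⟨.star_left _ hm, _, _, rfl, hm.starFree hU, hV⟩
  | star_right _ h =>
    cases e
    have hm := h.mred hV
    exact ⟨.star_right _ hm, _, _, rfl, hU, hm.starFree hV⟩
  | simp W U₁ V₁ x hW hx =>
    have hs : Sub (ckk U₁ V₁) (Term.star U V) := e ▸ sub_subst hx
    refine ⟨e ▸ .escape hs, _, _, rfl, ?_⟩
    have hf : StarFree (ckk U₁ V₁) := by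
      cases hs with
      | star_left hs => exact hs.starFree hU
      | star_right hs => exact hs.starFree hV
    exact ⟨hf.1.2.2, hf.2.2⟩
  | _ => cases e

theorem SN.stronglyNormalizing_star {U V : Term} (h : SN (Term.star U V)) (hU : StarFree U)
    (hV : StarFree V) : StronglyNormalizing Atom (Term.star U V) := by
  generalize e : Term.star U V = T at h
  induction h generalizing U V with
  | intro T _ ih =>
    subst e
    refine Acc.intro _ fun T' hr => ?_
    obtain ⟨hs, U', V', rfl, hU', hV'⟩ := Red.step_star hr hU hV
    exact ih _ hs hU' hV' rfl

end CCL

theorem mainTheorem1 {Atom : Type*} (Γ : CCL.Ctx Atom) (T : CCL.Term) (A : CCL.Ty Atom)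
    (hT : CCL.HasType Γ T A) : CCL.StronglyNormalizing Atom T := by
  cases A with
  | m A =>
    have h := hT.hasTy rfl
    exact (CCL.sn_of_mem h.mem_interp).stronglyNormalizing_of_starFree h.starFree
  | bot =>
    cases hT with
    | star A U V hU hV =>
      have hU := hU.hasTy rfl
      have hV := hV.hasTy rfl
      exact (CCL.sn_star_of_mem hV.mem_interp hU.mem_interp).2.stronglyNormalizing_star
        hU.starFree hV.starFree
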